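/- For $1\le\theta<2$ consider the degenerate wave equation $$u_{tt}-(x^\theta u_x)_x=0\ \text{ in } (0,\infty)\times(0,1),\qquad u(t,1)=0,\quad \lim_{x\downarrow 0}x^\theta u_x(t,x)=0,\qquad u(0,\cdot)=u_0,\ u_t(0,\cdot)=u_1. \tag{1}$$ Let $H^1_\theta$ be the space of all $f\in L^2(0,1)$ that are locally absolutely continuous in $(0,1]$ with $x^{\theta/2}f'\in L^2(0,1)$ and $f(1)=0$, and let $H^2_\theta$ be the space of all $f\in H^1_\theta$ with $x^\theta f'\in H^1(0,1)$. For $(u_0,u_1)\in H^1_\theta\times L^2(0,1)$ let $u\in C^1([0,\infty);L^2(0,1))\cap C([0,\infty);H^1_\theta)$ be the mild solution of (1), i.e. $(u,u_t)(t)=e^{tA}(u_0,u_1)$ with $A(f,g)=(g,(x^\theta f')')$ and $D(A)=H^2_\theta\times H^1_\theta$. Put $$E_u(0)=\tfrac12\int_0^1\big(u_1^2+x^\theta (u_0')^2\big)\,dx ,$$ and let $u_x(\cdot,1)\in L^2(0,T)$ be the normal derivative, defined for mild solutions as the $L^2(0,T)$-limit of the normal derivatives of classical solutions whose initial data in $D(A)$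 converge to $(u_0,u_1)$ in $H^1_\theta\times L^2(0,1)$. A number $C>0$ is an observability constant for (1) in time $T>0$ if $\int_0^T u_x(t,1)^2\,dt\ge C\,E_u(0)$ for all $(u_0,u_1)\in H^1_\theta\times L^2(0,1)$. Let $C_T(\theta)\in[0,\infty]$ be the supremum of all observability constants in time $T$ (with $\sup\emptyset=0$), and for $C>0$ let $T^*_\theta(C)\in[0,\infty]$ be the infimum of all $T>0$ such that $C$ is an observability constant in time $T$ (with $\inf\emptyset=\infty$). Then: 1. for every $T>0$ and every $\theta\in[1,2)$, $C_T(\theta)\le(2-\theta)T$; 2. hence, for every $T>0$, $C_T(\theta)\to0$ as $\theta\uparrow2$; 3. for every $C>0$ and every $\theta\in[1,2)$, $T^*_\theta(C)\ge \dfrac{C}{2-\theta}$; 4. hence, for every $C>0$, $T^*_\theta(C)\to\infty$ as $\theta\uparrow2$. -/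

import Mathlib

open MeasureTheory Set Filter Topology

noncomputable section

namespace DegWave

/-- Lebesgue measure on the open interval `(0,1)`. -/
def mu01 : Measure ℝ := volume.restrict (Ioo 0 1)

/-- `f ∈ L²(0,1)`. -/
def MemL2 (f : ℝ → ℝ) : Prop := MemLp f 2 mu01

/-- `f ∈ V¹ₐ(0,1)`: `f ∈ L²(0,1)`, `f` is locally absolutely continuous in `]0,1]` and
`√a f' ∈ L²(0,1)`. Functions are defined on all of `ℝ` for convenience; their values outside
`]0,1]` play no role. -/
structure MemV1 (a f : ℝ → ℝ) : Prop where
  memL2 : MemL2 f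
  locAC : ∀ c ∈ Ioc (0 : ℝ) 1, AbsolutelyContinuousOnInterval f c 1
  derivL2 : MemL2 fun x => √(a x) * deriv f x

/-- `g ∈ H¹(0,1)`: `g` coincides almost everywhere with an absolutely continuous function on
`[0,1]` whose derivative is in `L²(0,1)`. -/
def MemH1 (g : ℝ → ℝ) : Prop :=
  ∃ q : ℝ → ℝ, AbsolutelyContinuousOnInterval q 0 1 ∧ MemL2 (deriv q) ∧ g =ᵐ[mu01] q

/-- `f ∈ V²ₐ(0,1)`: `f ∈ V¹ₐ(0,1)` and `a f' ∈ H¹(0,1)`. -/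
def MemV2 (a f : ℝ → ℝ) : Prop := MemV1 a f ∧ MemH1 fun x => a x * deriv f x

/-- `f ∈ H¹ₐ(0,1)` for a strongly degenerate coefficient `a` (such as `x ^ θ`, `1 ≤ θ < 2`):
`f ∈ V¹ₐ(0,1)` and `f 1 = 0`. In the strongly degenerate case there is no condition at `0`. -/
def MemH1a (a f : ℝ → ℝ) : Prop := MemV1 a f ∧ f 1 = 0

/-- `f ∈ H²ₐ(0,1) = V²ₐ(0,1) ∩ H¹ₐ(0,1)`. In the strongly degenerate case its elements satisfy
the Neumann condition `a f' → 0` at `0` automatically. -/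
def MemH2a (a f : ℝ → ℝ) : Prop := MemV2 a f ∧ MemH1a a f

/-- The degenerate elliptic operator `f ↦ (a f')'`. -/
def ell (a f : ℝ → ℝ) : ℝ → ℝ := deriv fun x => a x * deriv f x

/-- The energy `½ ∫₀¹ (g² + a |f'|²) dx`, half the squared norm of `(f, g)` in the Hilbert space
`H¹ₐ(0,1) × L²(0,1)`. The energy of a solution `u` at time `t` is `energy a (u t) (u_t t)`. -/
def energy (a f g : ℝ → ℝ) : ℝ :=
  (1 / 2) * ∫ x in Ioo (0 : ℝ) 1, ((g x) ^ 2 + a x * (deriv f x) ^ 2)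

/-- `(u, v)` is the mild solution `e^{tA}(u₀, u₁)`, `t ≥ 0`, with `v = u_t`, of
`u_tt - (a u_x)_x = 0`, `u(t,1) = 0`, `(a u_x)(t,0) = 0`, `u(0) = u₀`, `u_t(0) = u₁`,
where `A (f, g) = (g, (a f')')` on `D(A) = H²ₐ × H¹ₐ`. That is,
`u ∈ C¹([0,∞); L²) ∩ C([0,∞); H¹ₐ)`, `u_t = v`, and `U = (u, v)` satisfies
`∫₀ᵗ U ds ∈ D(A)` and `U(t) = U(0) + A ∫₀ᵗ U ds` for all `t ≥ 0`
(the first component of this identity says `u_t = v`). Since `u ∈ C([0,∞); H¹ₐ)` and evaluation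
at a point of `]0,1]` is continuous on `H¹ₐ`, the integral `∫₀ᵗ u ds` is computed pointwise. -/
structure IsMildSolution (a u₀ u₁ : ℝ → ℝ) (u v : ℝ → ℝ → ℝ) : Prop where
  mem_u : ∀ t, 0 ≤ t → MemH1a a (u t)
  mem_v : ∀ t, 0 ≤ t → MemL2 (v t)
  cont : ∀ t, 0 ≤ t →
    Tendsto (fun s => energy a (u s - u t) (v s - v t)) (𝓝[Ici 0] t) (𝓝 0)
  hasDeriv : ∀ t, 0 ≤ t →
    Tendsto (fun s => eLpNorm ((s - t)⁻¹ • (u s - u t) - v t) 2 mu01) (𝓝[Ici 0 \ {t}] t) (𝓝 0)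
  init_u : ∀ x ∈ Ioc (0 : ℝ) 1, u 0 x = u₀ x
  init_v : v 0 =ᵐ[mu01] u₁
  mem_int : ∀ t, 0 ≤ t → MemH2a a fun x => ∫ s in (0 : ℝ)..t, u s x
  eqn : ∀ t, 0 ≤ t → v t =ᵐ[mu01] u₁ + ell a fun x => ∫ s in (0 : ℝ)..t, u s x

/-- `(u, v)`, with `v = u_t`, is a classical solution of the same problem: `U = (u, v)` is in
`C¹([0,∞); H¹ₐ × L²) ∩ C([0,∞); D(A))`, with `D(A) = H²ₐ × H¹ₐ`, and `U' = A U`, i.e.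
`u_t = v`, `v_t = (a u_x)_x`. -/
structure IsClassicalSolution (a : ℝ → ℝ) (u v : ℝ → ℝ → ℝ) : Prop where
  mem_u : ∀ t, 0 ≤ t → MemH2a a (u t)
  mem_v : ∀ t, 0 ≤ t → MemH1a a (v t)
  hasDeriv : ∀ t, 0 ≤ t →
    Tendsto (fun s => energy a ((s - t)⁻¹ • (u s - u t) - v t)
      ((s - t)⁻¹ • (v s - v t) - ell a (u t))) (𝓝[Ici 0 \ {t}] t) (𝓝 0)
  cont_deriv : ∀ t, 0 ≤ t →
    Tendsto (fun s => energy a (v s - v t) (ell a (u s) - ell a (u t))) (𝓝[Ici 0] t) (𝓝 0)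

/-- The derivative `f'(1)` at the right end point of `]0,1]`. -/
def derivAtOne (f : ℝ → ℝ) : ℝ := derivWithin f (Iic 1) 1

/-- `g ∈ L²(0,T)` is the normal derivative `u_x(·,1)` on `(0,T)` of the mild solution `(u, v)`:
the limit in `L²(0,T)` of the (pointwise defined) normal derivatives of classical solutions
whose initial data converge to those of `(u, v)` in `H¹ₐ × L²`. -/
def IsNormalDeriv (a : ℝ → ℝ) (T : ℝ) (u v : ℝ → ℝ → ℝ) (g : ℝ → ℝ) : Prop :=
  MemLp g 2 (volume.restrict (Ioo 0 T)) ∧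
  ∃ un vn : ℕ → ℝ → ℝ → ℝ,
    (∀ n, IsClassicalSolution a (un n) (vn n)) ∧
    Tendsto (fun n => energy a (un n 0 - u 0) (vn n 0 - v 0)) atTop (𝓝 0) ∧
    Tendsto (fun n => eLpNorm (fun t => derivAtOne (un n t) - g t) 2 (volume.restrict (Ioo 0 T)))
      atTop (𝓝 0)

/-- `C > 0` is an observability constant in time `T`: for all initial data
`(u₀, u₁) ∈ H¹ₐ × L²` the mild solution satisfies `∫₀ᵀ u_x(t,1)² dt ≥ C E_u(0)`. -/
def IsObsConst (a : ℝ → ℝ) (T C : ℝ) : Prop :=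
  0 < C ∧ ∀ u₀ u₁ : ℝ → ℝ, MemH1a a u₀ → MemL2 u₁ →
    ∀ (u v : ℝ → ℝ → ℝ) (g : ℝ → ℝ), IsMildSolution a u₀ u₁ u v → IsNormalDeriv a T u v g →
      C * energy a (u 0) (v 0) ≤ ∫ t in Ioo 0 T, (g t) ^ 2

/-- `C_T`: the supremum, in `[0,∞]`, of all observability constants in time `T`
(`0` if there are none). -/
def obsConst (a : ℝ → ℝ) (T : ℝ) : ENNReal :=
  ⨆ (C : ℝ) (_ : IsObsConst a T C), ENNReal.ofReal C

/-- `T*(C)`: the infimum, in `[0,∞]`, of all times `T > 0` such that `C` is an observability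
constant in time `T` (`∞` if there are none). -/
def obsTime (a : ℝ → ℝ) (C : ℝ) : ENNReal :=
  ⨅ (T : ℝ) (_ : 0 < T ∧ IsObsConst a T C), ENNReal.ofReal T

/-- The power coefficient `a(x) = x ^ θ`. -/
def powerCoeff (θ : ℝ) : ℝ → ℝ := fun x => x ^ θ

end DegWave

end

/-! Every observability constant is tested on one standing wave `u(t,x) = c(t) f(x)`. Here `-(x^θ
f')' = λ f` with zero flux at `0` and `f(1) = 0`, and `c` is `cos (√λ t)` or `sin (√λ t)`, so that
`E_u(0) = (λ/2) ∫ f²`. The multiplier identity `flux_one_sq` gives `f'(1)² = (2 - θ) λ ∫ f²`, and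
one of the two phases has `∫₀ᵀ c² ≤ T/2`. Hence the observed quantity is at most `(2 - θ) T E_u(0)`,
which is `IsObsConst.le`; all four claims follow from it.

The eigenfunction comes from an entire series in `x^(2-θ)` that solves the equation with `λ = 1`.
This solution has a positive zero (`IsNeumannSolution.exists_zero`), and dilation moves the zero to
`1`. -/

noncomputable section

namespace DegWave

/-! ### Entire power series and their derivatives -/

/-- A power series whose coefficients are dominated by those of an exponential converges absolutely
everywhere. -/
theorem summable_of_coeff_le {a : ℕ → ℝ} {K M : ℝ} (ha : ∀ k, |a k| ≤ K * M ^ k / k.factorial)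
    (R : ℝ) : Summable fun k => |a k| * |R| ^ k := by
  refine Summable.of_nonneg_of_le (fun k => by positivity) (fun k => ?_)
    ((Real.summable_pow_div_factorial (M * |R|)).mul_left K)
  calc |a k| * |R| ^ k ≤ K * M ^ k / k.factorial * |R| ^ k := by gcongr; exact ha k
    _ = _ := by rw [mul_pow]; ring

theorem summable_powerSeries {a : ℕ → ℝ} {K M : ℝ}
    (ha : ∀ k, |a k| ≤ K * M ^ k / k.factorial) (z : ℝ) : Summable fun k => a k * z ^ k := by
  refine Summable.of_norm ?_
  simpa [abs_mul, abs_pow] using summable_of_coeff_le ha z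

/-- The factorial bound survives formal differentiation with `K` replaced by `K * M`, so termwise
differentiation can be iterated. -/
theorem deriv_coeff_le {a : ℕ → ℝ} {K M : ℝ} (ha : ∀ k, |a k| ≤ K * M ^ k / k.factorial)
    (k : ℕ) : |((k : ℝ) + 1) * a (k + 1)| ≤ K * M * M ^ k / k.factorial := by
  have h := ha (k + 1)
  rw [abs_mul, abs_of_pos (by positivity : (0 : ℝ) < (k : ℝ) + 1)]
  calc ((k : ℝ) + 1) * |a (k + 1)|
      ≤ ((k : ℝ) + 1) * (K * M ^ (k + 1) / (k + 1).factorial) := by gcongr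
    _ = _ := by
      rw [Nat.factorial_succ]; push_cast
      have : (k.factorial : ℝ) ≠ 0 := by positivity
      field_simp
      ring

theorem hasDerivAt_powerSeries {a : ℕ → ℝ} {K M : ℝ}
    (ha : ∀ k, |a k| ≤ K * M ^ k / k.factorial) (z : ℝ) :
    HasDerivAt (fun z => ∑' k, a k * z ^ k) (∑' k : ℕ, ((k : ℝ) + 1) * a (k + 1) * z ^ k) z := by
  set R := |z| + 1
  have hR : 0 < R := by positivity
  have hsum : Summable fun k : ℕ => |a k| * (k * R ^ (k - 1)) := by
    rw [← summable_nat_add_iff 1]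
    refine (summable_of_coeff_le (deriv_coeff_le ha) R).congr fun k => ?_
    rw [abs_mul, abs_of_pos (by positivity : (0 : ℝ) < (k : ℝ) + 1), abs_of_pos hR]
    rw [Nat.add_sub_cancel]
    push_cast
    ring
  have hb : ∀ (n : ℕ) y, y ∈ Metric.ball (0 : ℝ) R →
      ‖a n * (n * y ^ (n - 1))‖ ≤ |a n| * (n * R ^ (n - 1)) := by
    intro n y hy
    rw [mem_ball_zero_iff, Real.norm_eq_abs] at hy
    rw [Real.norm_eq_abs, abs_mul, abs_mul, abs_pow, Nat.abs_cast]
    gcongr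
  have hz : z ∈ Metric.ball (0 : ℝ) R := by
    rw [mem_ball_zero_iff, Real.norm_eq_abs]; simp [R]
  have h := hasDerivAt_tsum_of_isPreconnected (g := fun k y => a k * y ^ k)
    (g' := fun k y => a k * (k * y ^ (k - 1))) hsum Metric.isOpen_ball
    (convex_ball (0 : ℝ) R).isPreconnected
    (fun n y _ => (hasDerivAt_pow n y).const_mul (a n)) hb hz (summable_powerSeries ha z) hz
  refine h.congr_deriv ?_
  rw [(Summable.of_norm_bounded hsum fun n => hb n z hz).tsum_eq_zero_add]
  simp only [Nat.cast_zero, zero_mul, mul_zero, zero_add, Nat.add_sub_cancel]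
  refine tsum_congr fun k => ?_
  push_cast
  ring

/-! ### The regular solution at the degenerate point -/

/-- The coefficients of the entire function `F` such that `F (x ^ α)`, `α = 2 - θ`, solves
`-(x ^ θ f')' = f`. -/
def besselCoeff (α : ℝ) : ℕ → ℝ
  | 0 => 1
  | k + 1 => -besselCoeff α k / (α * (k + 1) * (α * k + 1))

theorem abs_besselCoeff_le {α : ℝ} (hα : 0 < α) (k : ℕ) :
    |besselCoeff α k| ≤ 1 * α⁻¹ ^ k / k.factorial := by
  induction k with
  | zero => simp [besselCoeff]
  | succ k ih =>
    have h1 : α * (k + 1) ≤ α * (k + 1) * (α * k + 1) :=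
      le_mul_of_one_le_right (by positivity) (by nlinarith [mul_nonneg hα.le k.cast_nonneg (α := ℝ)])
    rw [besselCoeff, abs_div, abs_neg,
      abs_of_pos (by positivity : 0 < α * ((k : ℝ) + 1) * (α * k + 1))]
    calc _ ≤ 1 * α⁻¹ ^ k / k.factorial / (α * (k + 1)) := by gcongr
      _ = _ := by
        rw [Nat.factorial_succ, pow_succ]; push_cast
        field_simp

/-- A solution of `-(x ^ θ f')' = lam f` on `]0,∞[`, in first order form with flux
`q = x ^ θ f'`, such that `f` is continuous and `q` vanishes at `0`. -/
structure IsNeumannSolution (θ lam : ℝ) (f q : ℝ → ℝ) : Prop where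
  cont : Continuous f
  ne_zero : f 0 ≠ 0
  hasDeriv : ∀ x, 0 < x → HasDerivAt f (x ^ (-θ) * q x) x
  hasDeriv_flux : ∀ x, HasDerivAt q (-lam * f x) x
  flux_zero : q 0 = 0

/-- With `f = F (x ^ α)` and `α = 2 - θ`, the flux `x^θ f'` is `α x F'(x^α)`. The equation becomes
`α F' + α² z F'' = -F` in `z = x^α`, which is the recursion `α (k+1) (α k + 1) a_{k+1} = -a_k`. -/
theorem exists_isNeumannSolution {θ : ℝ} (hθ : θ < 2) :
    ∃ f q, IsNeumannSolution θ 1 f q := by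
  set α := 2 - θ with hαdef
  have hα : 0 < α := by linarith
  set a := besselCoeff α
  have ha : ∀ k, |a k| ≤ 1 * α⁻¹ ^ k / k.factorial := abs_besselCoeff_le hα
  have ha' := deriv_coeff_le ha
  have ha'' := deriv_coeff_le ha'
  set F : ℝ → ℝ := fun z => ∑' k, a k * z ^ k with hF
  set G : ℝ → ℝ := fun z => ∑' k : ℕ, ((k : ℝ) + 1) * a (k + 1) * z ^ k with hG
  set H : ℝ → ℝ := fun z => ∑' k : ℕ, ((k : ℝ) + 1) * (((k + 1 : ℕ) : ℝ) + 1) * a (k + 2) * z ^ k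
    with hH
  have hFd : ∀ z, HasDerivAt F (G z) z := hasDerivAt_powerSeries ha
  have hGd : ∀ z, HasDerivAt G (H z) z := fun z => by
    convert hasDerivAt_powerSeries ha' z using 1
    simp only [hH]
    refine tsum_congr fun k => by ring
  have hFc : Continuous F := continuous_iff_continuousAt.2 fun z => (hFd z).continuousAt
  have hGc : Continuous G := continuous_iff_continuousAt.2 fun z => (hGd z).continuousAt
  have hode : ∀ z, α * G z + α ^ 2 * (z * H z) = - F z := by
    intro z
    have sF := summable_powerSeries ha z
    have sG := summable_powerSeries ha' z
    have sH := summable_powerSeries ha'' z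
    have hzH : z * H z = ∑' k : ℕ, (k : ℝ) * ((k : ℝ) + 1) * a (k + 1) * z ^ k ∧
        Summable fun k : ℕ => (k : ℝ) * ((k : ℝ) + 1) * a (k + 1) * z ^ k := by
      have hs : Summable fun k : ℕ => (k : ℝ) * ((k : ℝ) + 1) * a (k + 1) * z ^ k := by
        rw [← summable_nat_add_iff 1]
        refine (sH.mul_left z).congr fun k => ?_
        push_cast; ring
      refine ⟨?_, hs⟩
      rw [hs.tsum_eq_zero_add, hH]
      simp only [Nat.cast_zero, zero_mul, zero_add]
      rw [← tsum_mul_left]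
      refine tsum_congr fun k => ?_
      push_cast; ring
    rw [hzH.1, hG, hF, ← tsum_mul_left, ← tsum_mul_left, ← tsum_neg,
      ← (sG.mul_left α).tsum_add (hzH.2.mul_left (α ^ 2))]
    refine tsum_congr fun k => ?_
    have : a (k + 1) = -a k / (α * (k + 1) * (α * k + 1)) := rfl
    rw [this]
    have h1 : (α * k + 1 : ℝ) ≠ 0 := by positivity
    field_simp
    ring
  have hfc : Continuous fun x : ℝ => F (x ^ α) :=
    hFc.comp (Real.continuous_rpow_const hα.le)
  set p : ℝ → ℝ := fun x => α * x * G (x ^ α) with hp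
  have hpc : Continuous p := by
    have := hGc.comp (Real.continuous_rpow_const hα.le)
    exact (continuous_const.mul continuous_id).mul this
  have hpd : ∀ x, 0 < x → HasDerivAt p (- F (x ^ α)) x := by
    intro x hx
    have h1 := (hGd (x ^ α)).comp x (Real.hasDerivAt_rpow_const (p := α) (Or.inl hx.ne'))
    have h2 := ((hasDerivAt_id x).const_mul α).mul h1
    refine h2.congr_deriv ?_
    rw [← hode, Real.rpow_sub_one hx.ne']
    simp only [id, Function.comp]
    field_simp
  -- The flux equation is required at every real `x`, while `p` is differentiated only for `x > 0`.
  -- The primitive of the continuous function `-F (y ^ α)` satisfies it everywhere and equals `p` on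
  -- `x > 0`.
  set q : ℝ → ℝ := fun x => ∫ y in (0 : ℝ)..x, - F (y ^ α) with hq
  have hqp : ∀ x, 0 < x → q x = p x := by
    intro x hx
    have := intervalIntegral.integral_eq_sub_of_hasDerivAt_of_le hx.le hpc.continuousOn
      (fun y hy => hpd y hy.1) (hfc.neg.intervalIntegrable 0 x)
    rw [hq]; simp only
    rw [this]; simp [hp]
  refine ⟨fun x => F (x ^ α), q, hfc, ?_, ?_, ?_, ?_⟩
  · simp only [Real.zero_rpow hα.ne', hF]
    rw [tsum_eq_single 0 (fun k hk => by simp [hk])]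
    simp [a, besselCoeff]
  · intro x hx
    have h1 := (hFd (x ^ α)).comp x (Real.hasDerivAt_rpow_const (p := α) (Or.inl hx.ne'))
    refine h1.congr_deriv ?_
    rw [hqp x hx, hp]
    have : x ^ (α - 1) = x ^ (-θ) * x := by
      rw [← Real.rpow_add_one hx.ne', hαdef]; ring_nf
    simp only [this]; ring
  · intro x
    have := (hfc.neg.integral_hasStrictDerivAt 0 x).hasDerivAt
    simpa [hq] using this
  · simp [hq]

/-! ### A positive zero, and the eigenfunction by dilation -/

theorem IsNeumannSolution.neg {θ lam : ℝ} {f q : ℝ → ℝ} (h : IsNeumannSolution θ lam f q) :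
    IsNeumannSolution θ lam (fun x => -f x) (fun x => -q x) where
  cont := h.cont.neg
  ne_zero := neg_ne_zero.2 h.ne_zero
  hasDeriv x hx := (h.hasDeriv x hx).neg.congr_deriv (by ring)
  hasDeriv_flux x := (h.hasDeriv_flux x).neg.congr_deriv (by ring)
  flux_zero := by simp [h.flux_zero]

/-- If `f` stayed positive, `q` and `f` would decrease, so `q ≤ -x f(x)` beyond `x`. Then `f` drops
on `[x, 2x]` by at least `(2x)^(-θ) x² f(x)`. This exceeds or equals `f(x)` for large `x` because `θ
< 2`, forcing `f(2x) ≤ 0`. -/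
theorem IsNeumannSolution.not_forall_pos {θ : ℝ} (h0 : 0 ≤ θ) (hθ : θ < 2) {f q : ℝ → ℝ}
    (h : IsNeumannSolution θ 1 f q) : ¬ ∀ x, 0 < x → 0 < f x := by
  intro hf
  have hqc : Continuous q := continuous_iff_continuousAt.2 fun z => (h.hasDeriv_flux z).continuousAt
  have hqanti : StrictAntiOn q (Ici 0) := by
    refine strictAntiOn_of_deriv_neg (convex_Ici 0) hqc.continuousOn fun x hx => ?_
    rw [interior_Ici] at hx
    rw [(h.hasDeriv_flux x).deriv]
    linarith [hf x hx]
  have hqneg : ∀ x, 0 < x → q x < 0 := fun x hx => by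
    have := hqanti (mem_Ici.2 le_rfl) (mem_Ici.2 hx.le) hx
    rwa [h.flux_zero] at this
  have hfanti : StrictAntiOn f (Ici 0) := by
    refine strictAntiOn_of_deriv_neg (convex_Ici 0) h.cont.continuousOn fun x hx => ?_
    rw [interior_Ici] at hx
    rw [(h.hasDeriv x hx).deriv]
    exact mul_neg_of_pos_of_neg (Real.rpow_pos_of_pos hx _) (hqneg x hx)
  have hα : 0 < 2 - θ := by linarith
  -- The threshold is equivalent to `(2x)^(-θ) x² ≥ 1`.
  obtain ⟨x, hx0, hx⟩ : ∃ x : ℝ, 0 < x ∧ 2 ^ θ ≤ x ^ (2 - θ) := by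
    obtain ⟨x, h1, h2⟩ := (((tendsto_rpow_atTop hα).eventually_ge_atTop ((2 : ℝ) ^ θ)).and
      (eventually_gt_atTop 0)).exists
    exact ⟨x, h2, h1⟩
  -- the flux at `x` is at least `x * f x` in absolute value
  obtain ⟨y, hy, hqy⟩ := exists_hasDerivAt_eq_slope q _ hx0 hqc.continuousOn
    fun y _ => h.hasDeriv_flux y
  obtain ⟨z, hz, hfz⟩ := exists_hasDerivAt_eq_slope f _ (by linarith : x < 2 * x)
    h.cont.continuousOn fun y hy => h.hasDeriv y (hx0.trans hy.1)
  have hz0 : 0 < z := hx0.trans hz.1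
  have h1 : q x ≤ - (x * f x) := by
    have := hfanti.antitoneOn (mem_Ici.2 hy.1.le) (mem_Ici.2 hx0.le) hy.2.le
    rw [h.flux_zero, sub_zero, sub_zero, eq_div_iff hx0.ne'] at hqy
    nlinarith
  have h2 : q z ≤ q x :=
    hqanti.antitoneOn (mem_Ici.2 hx0.le) (mem_Ici.2 hz0.le) hz.1.le
  have h3 : (2 * x) ^ (-θ) ≤ z ^ (-θ) :=
    Real.rpow_le_rpow_of_nonpos hz0 hz.2.le (by linarith)
  have h4 : f (2 * x) - f x = z ^ (-θ) * q z * x := by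
    rw [hfz]; field_simp; ring
  have h5 : 1 ≤ (2 * x) ^ (-θ) * x * x := by
    rw [Real.mul_rpow (by norm_num) hx0.le, Real.rpow_neg (by norm_num)]
    have : x ^ (2 - θ) = x ^ (-θ) * x * x := by
      rw [← Real.rpow_add_one hx0.ne', ← Real.rpow_add_one hx0.ne']; ring_nf
    rw [this] at hx
    rw [mul_assoc, mul_assoc, ← mul_assoc (x ^ (-θ)), ← div_eq_inv_mul, one_le_div (by positivity)]
    exact hx
  have h6 : x * f x ≤ - q z := by linarith
  have hfx := hf x hx0
  have h7 : f x ≤ z ^ (-θ) * (- q z) * x := by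
    calc f x ≤ ((2 * x) ^ (-θ) * x * x) * f x := le_mul_of_one_le_left hfx.le h5
      _ = (2 * x) ^ (-θ) * (x * f x) * x := by ring
      _ ≤ z ^ (-θ) * (- q z) * x := by gcongr
  linarith [hf (2 * x) (by linarith)]

theorem IsNeumannSolution.exists_zero {θ : ℝ} (h0 : 0 ≤ θ) (hθ : θ < 2) {f q : ℝ → ℝ}
    (h : IsNeumannSolution θ 1 f q) : ∃ x, 0 < x ∧ f x = 0 := by
  by_contra! hne
  have key : ∀ x, 0 ≤ x → f x ≠ 0 := fun x hx => by
    rcases hx.eq_or_lt with rfl | hx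
    exacts [h.ne_zero, hne x hx]
  have hsign : ∀ x, 0 < x → 0 < f 0 * f x := by
    intro x hx
    by_contra! hle
    obtain ⟨y, hy, hfy⟩ : ∃ y ∈ Icc 0 x, f 0 * f y = 0 :=
      intermediate_value_Icc' (f := fun y => f 0 * f y) hx.le
        (continuous_const.mul h.cont).continuousOn ⟨hle, mul_self_nonneg _⟩
    exact mul_ne_zero h.ne_zero (key y hy.1) hfy
  rcases h.ne_zero.lt_or_gt with hlt | hgt
  · exact h.neg.not_forall_pos h0 hθ fun x hx =>
      neg_pos.2 (neg_of_mul_pos_right (hsign x hx) hlt.le)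
  · exact h.not_forall_pos h0 hθ fun x hx => pos_of_mul_pos_right (hsign x hx) hgt.le

/-- Taking `ρ` to be a zero of `f` places the Dirichlet condition at `1`; the eigenvalue is then `ρ
^ (2 - θ)`. -/
theorem IsNeumannSolution.rescale {θ ρ : ℝ} (hρ : 0 < ρ) {f q : ℝ → ℝ}
    (h : IsNeumannSolution θ 1 f q) :
    IsNeumannSolution θ (ρ ^ (2 - θ)) (fun x => f (ρ * x)) (fun x => ρ ^ (1 - θ) * q (ρ * x)) where
  cont := h.cont.comp (continuous_const.mul continuous_id)
  ne_zero := by simpa using h.ne_zero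
  hasDeriv x hx := by
    have h1 : HasDerivAt (fun x => ρ * x) ρ x := by simpa using (hasDerivAt_id x).const_mul ρ
    refine ((h.hasDeriv (ρ * x) (by positivity)).comp x h1).congr_deriv ?_
    rw [Real.mul_rpow hρ.le hx.le, show 1 - θ = -θ + 1 by ring, Real.rpow_add_one hρ.ne']
    ring
  hasDeriv_flux x := by
    have h1 : HasDerivAt (fun x => ρ * x) ρ x := by simpa using (hasDerivAt_id x).const_mul ρ
    refine (((h.hasDeriv_flux (ρ * x)).comp x h1).const_mul _).congr_deriv ?_
    rw [show 2 - θ = 1 - θ + 1 by ring, Real.rpow_add_one hρ.ne']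
    ring
  flux_zero := by simp [h.flux_zero]

/-- There is an eigenfunction of the degenerate operator on `]0,1]`. -/
theorem exists_eigenfunction {θ : ℝ} (h0 : 0 ≤ θ) (hθ : θ < 2) :
    ∃ lam f q, 0 < lam ∧ IsNeumannSolution θ lam f q ∧ f 1 = 0 := by
  obtain ⟨f, q, h⟩ := exists_isNeumannSolution hθ
  obtain ⟨ρ, hρ, hz⟩ := h.exists_zero h0 hθ
  exact ⟨_, _, _, Real.rpow_pos_of_pos hρ _, h.rescale hρ, by simpa using hz⟩

/-! ### Scalar multiples and regularity criteria -/

theorem deriv_const_smul_fun (c : ℝ) (f : ℝ → ℝ) : deriv (c • f) = c • deriv f := by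
  ext x
  exact deriv_const_mul_field c

theorem MemV1.const_smul {a f : ℝ → ℝ} (h : MemV1 a f) (c : ℝ) : MemV1 a (c • f) where
  memL2 := MemLp.const_smul h.memL2 c
  locAC x hx := (h.locAC x hx).const_mul c
  derivL2 := by
    rw [deriv_const_smul_fun]
    refine (memLp_congr_ae (ae_of_all _ fun x => ?_)).1 (MemLp.const_smul h.derivL2 c)
    simp only [Pi.smul_apply, smul_eq_mul]
    ring

theorem MemH1a.const_smul {a f : ℝ → ℝ} (h : MemH1a a f) (c : ℝ) : MemH1a a (c • f) :=
  ⟨h.1.const_smul c, by simp [h.2]⟩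

theorem flux_const_smul (a : ℝ → ℝ) (c : ℝ) (f : ℝ → ℝ) :
    (fun x => a x * deriv (c • f) x) = c • fun x => a x * deriv f x := by
  ext x
  rw [deriv_const_smul_fun]
  simp only [Pi.smul_apply, smul_eq_mul]
  ring

theorem ell_const_smul (a : ℝ → ℝ) (c : ℝ) (f : ℝ → ℝ) : ell a (c • f) = c • ell a f := by
  rw [ell, flux_const_smul, deriv_const_smul_fun, ell]

theorem MemH1.const_smul {g : ℝ → ℝ} (h : MemH1 g) (c : ℝ) : MemH1 (c • g) := by
  obtain ⟨q, hq, hq', hgq⟩ := h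
  refine ⟨c • q, hq.const_mul c, ?_, hgq.const_smul c⟩
  rw [deriv_const_smul_fun]
  exact MemLp.const_smul hq' c

theorem MemH2a.const_smul {a f : ℝ → ℝ} (h : MemH2a a f) (c : ℝ) : MemH2a a (c • f) := by
  refine ⟨⟨h.1.1.const_smul c, ?_⟩, h.2.const_smul c⟩
  rw [flux_const_smul]
  exact h.1.2.const_smul c

theorem absolutelyContinuousOnInterval_of_hasDerivAt {f f' : ℝ → ℝ} {a b : ℝ}
    (hf : ∀ x ∈ uIcc a b, HasDerivAt f (f' x) x) (hf' : ContinuousOn f' (uIcc a b)) :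
    AbsolutelyContinuousOnInterval f a b := by
  obtain ⟨C, hC⟩ := isCompact_uIcc.exists_bound_of_continuousOn hf'
  exact ((convex_uIcc a b).lipschitzOnWith_of_nnnorm_hasDerivWithin_le (C := C.toNNReal)
    (fun x hx => (hf x hx).hasDerivWithinAt)
    fun x hx => by
      rw [← NNReal.coe_le_coe, coe_nnnorm]
      exact (hC x hx).trans (Real.le_coe_toNNReal C)).absolutelyContinuousOnInterval

theorem memL2_of_continuousOn {f : ℝ → ℝ} (hf : ContinuousOn f (Icc 0 1)) : MemL2 f := by
  obtain ⟨C, hC⟩ := isCompact_Icc.exists_bound_of_continuousOn hf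
  have : IsFiniteMeasure mu01 := by unfold mu01; infer_instance
  refine MemLp.of_bound
    ((hf.mono Ioo_subset_Icc_self).aestronglyMeasurable measurableSet_Ioo) C ?_
  filter_upwards [ae_restrict_mem measurableSet_Ioo] with x hx
  exact hC x (Ioo_subset_Icc_self hx)

theorem energy_const_smul {a f g : ℝ → ℝ} (c d : ℝ)
    (hg : IntegrableOn (fun x => g x ^ 2) (Ioo 0 1))
    (hf : IntegrableOn (fun x => a x * deriv f x ^ 2) (Ioo 0 1)) :
    energy a (c • f) (d • g) = (1 / 2) * (d ^ 2 * (∫ x in Ioo 0 1, g x ^ 2) +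
      c ^ 2 * ∫ x in Ioo 0 1, a x * deriv f x ^ 2) := by
  rw [energy, deriv_const_smul_fun, ← integral_const_mul (d ^ 2), ← integral_const_mul (c ^ 2),
    ← integral_add (hg.const_mul _) (hf.const_mul _)]
  congr 2
  ext x
  simp only [Pi.smul_apply, smul_eq_mul]
  ring

/-! ### Regularity and integral identities of the eigenfunction -/

namespace IsNeumannSolution

variable {θ lam : ℝ} {f q : ℝ → ℝ}

theorem continuous_flux (h : IsNeumannSolution θ lam f q) : Continuous q :=
  continuous_iff_continuousAt.2 fun z => (h.hasDeriv_flux z).continuousAt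

theorem exists_abs_flux_le (h : IsNeumannSolution θ lam f q) :
    ∃ K, ∀ x ∈ Icc (0 : ℝ) 1, |q x| ≤ K * x := by
  obtain ⟨K, hK⟩ := isCompact_Icc.exists_bound_of_continuousOn
    (s := Icc (0 : ℝ) 1) (f := fun x => -lam * f x) (continuous_const.mul h.cont).continuousOn
  refine ⟨K, fun x hx => ?_⟩
  have := (convex_Icc (0 : ℝ) 1).norm_image_sub_le_of_norm_hasDerivWithin_le
    (fun y _ => (h.hasDeriv_flux y).hasDerivWithinAt) hK (left_mem_Icc.2 zero_le_one) hx
  rwa [h.flux_zero, sub_zero, sub_zero, Real.norm_eq_abs, Real.norm_eq_abs,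
    abs_of_nonneg hx.1] at this

/-- This is the energy density `x^θ f'²` written with the flux. Since `|q| ≤ K x`, it is at most `K²
x^(2-θ)`, which tends to `0` at the degenerate end. -/
theorem continuousOn_density (h : IsNeumannSolution θ lam f q) (hθ : θ < 2) :
    ContinuousOn (fun x => x ^ (-θ) * q x ^ 2) (Icc 0 1) := by
  intro x hx
  rcases hx.1.eq_or_lt with rfl | hx0
  · obtain ⟨K, hK⟩ := h.exists_abs_flux_le
    have hα : 0 < 2 - θ := by linarith
    have hlim : Tendsto (fun x : ℝ => K ^ 2 * x ^ (2 - θ)) (𝓝[Icc 0 1] 0) (𝓝 0) := by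
      have := ((Real.continuous_rpow_const hα.le).tendsto 0).const_mul (K ^ 2)
      rw [Real.zero_rpow hα.ne', mul_zero] at this
      exact this.mono_left nhdsWithin_le_nhds
    rw [ContinuousWithinAt, h.flux_zero, zero_pow two_ne_zero, mul_zero]
    refine squeeze_zero' ?_ ?_ hlim
    · filter_upwards [self_mem_nhdsWithin] with y hy
      exact mul_nonneg (Real.rpow_nonneg hy.1 _) (sq_nonneg _)
    · filter_upwards [self_mem_nhdsWithin] with y hy
      rcases hy.1.eq_or_lt with rfl | hy0
      · simp [h.flux_zero, Real.zero_rpow hα.ne']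
      · calc y ^ (-θ) * q y ^ 2 ≤ y ^ (-θ) * (K * y) ^ 2 := by
              gcongr y ^ (-θ) * ?_
              rw [← sq_abs]
              exact pow_le_pow_left₀ (abs_nonneg _) (hK y hy) 2
          _ = K ^ 2 * y ^ (2 - θ) := by
              rw [show 2 - θ = -θ + 2 by ring, Real.rpow_add hy0, Real.rpow_two]
              ring
  · exact ((Real.continuousAt_rpow_const x (-θ) (Or.inl hx0.ne')).mul
      (h.continuous_flux.continuousAt.pow 2)).continuousWithinAt

theorem deriv_eq (h : IsNeumannSolution θ lam f q) {x : ℝ} (hx : 0 < x) :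
    deriv f x = x ^ (-θ) * q x := (h.hasDeriv x hx).deriv

theorem flux_eq (h : IsNeumannSolution θ lam f q) {x : ℝ} (hx : 0 < x) :
    powerCoeff θ x * deriv f x = q x := by
  rw [h.deriv_eq hx, powerCoeff, ← mul_assoc, ← Real.rpow_add hx]
  simp

theorem density_eq (h : IsNeumannSolution θ lam f q) {x : ℝ} (hx : 0 < x) :
    powerCoeff θ x * deriv f x ^ 2 = x ^ (-θ) * q x ^ 2 := by
  rw [sq, ← mul_assoc, h.flux_eq hx, h.deriv_eq hx]
  ring

theorem ell_eq (h : IsNeumannSolution θ lam f q) {x : ℝ} (hx : 0 < x) :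
    ell (powerCoeff θ) f x = -lam * f x := by
  have : (fun y => powerCoeff θ y * deriv f y) =ᶠ[𝓝 x] q := by
    filter_upwards [lt_mem_nhds hx] with y hy using h.flux_eq hy
  rw [ell, this.deriv_eq, (h.hasDeriv_flux x).deriv]

theorem integrableOn_density (h : IsNeumannSolution θ lam f q) (hθ : θ < 2) :
    IntegrableOn (fun x => powerCoeff θ x * deriv f x ^ 2) (Ioo 0 1) :=
  ((h.continuousOn_density hθ).integrableOn_Icc.mono_set Ioo_subset_Icc_self).congr_fun
    (fun _ hx => (h.density_eq hx.1).symm) measurableSet_Ioo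

theorem integrableOn_sq (h : IsNeumannSolution θ lam f q) :
    IntegrableOn (fun x => f x ^ 2) (Ioo 0 1) :=
  (h.cont.pow 2).continuousOn.integrableOn_Icc.mono_set Ioo_subset_Icc_self

theorem setIntegral_density (h : IsNeumannSolution θ lam f q) :
    ∫ x in Ioo 0 1, powerCoeff θ x * deriv f x ^ 2 = ∫ x in (0 : ℝ)..1, x ^ (-θ) * q x ^ 2 := by
  rw [intervalIntegral.integral_of_le zero_le_one, integral_Ioc_eq_integral_Ioo]
  exact setIntegral_congr_fun measurableSet_Ioo fun x hx => h.density_eq hx.1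

theorem setIntegral_sq :
    ∫ x in Ioo (0 : ℝ) 1, f x ^ 2 = ∫ x in (0 : ℝ)..1, f x ^ 2 := by
  rw [intervalIntegral.integral_of_le zero_le_one, integral_Ioc_eq_integral_Ioo]

theorem memH1a (h : IsNeumannSolution θ lam f q) (hθ : θ < 2) (h1 : f 1 = 0) :
    MemH1a (powerCoeff θ) f := by
  refine ⟨⟨memL2_of_continuousOn h.cont.continuousOn, fun c hc => ?_, ?_⟩, h1⟩
  · refine absolutelyContinuousOnInterval_of_hasDerivAt
      (f' := fun x => x ^ (-θ) * q x) (fun x hx => ?_) fun x hx => ?_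
    all_goals
      rw [uIcc_of_le hc.2] at hx
      have hx0 : 0 < x := hc.1.trans_le hx.1
    · exact h.hasDeriv x hx0
    · exact ((Real.continuousAt_rpow_const x (-θ) (Or.inl hx0.ne')).mul
        h.continuous_flux.continuousAt).continuousWithinAt
  · have hm : AEStronglyMeasurable (fun x => √(powerCoeff θ x) * deriv f x) mu01 := by
      refine Measurable.aestronglyMeasurable ?_
      exact ((measurable_id.pow_const θ).sqrt).mul (measurable_deriv f)
    refine (memLp_two_iff_integrable_sq hm).2 ?_
    refine (h.integrableOn_density hθ).congr_fun (fun x hx => ?_) measurableSet_Ioo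
    simp only [mul_pow]
    rw [Real.sq_sqrt (show 0 ≤ powerCoeff θ x from Real.rpow_nonneg hx.1.le θ)]

theorem memH2a (h : IsNeumannSolution θ lam f q) (hθ : θ < 2) (h1 : f 1 = 0) :
    MemH2a (powerCoeff θ) f := by
  have hc : Continuous fun x => -lam * f x := continuous_const.mul h.cont
  refine ⟨⟨(h.memH1a hθ h1).1, q, ?_, ?_, ?_⟩, h.memH1a hθ h1⟩
  · exact absolutelyContinuousOnInterval_of_hasDerivAt (fun x _ => h.hasDeriv_flux x)
      hc.continuousOn
  · rw [show deriv q = fun x => -lam * f x from funext fun x => (h.hasDeriv_flux x).deriv]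
    exact memL2_of_continuousOn hc.continuousOn
  · filter_upwards [ae_restrict_mem measurableSet_Ioo] with x hx using h.flux_eq hx.1

/-- Integrate `(f q)' = x^(-θ) q² - lam f²`; both boundary terms vanish, by `f 1 = 0` and `q 0 = 0`.
-/
theorem mul_integral_sq (h : IsNeumannSolution θ lam f q) (hθ : θ < 2) (h1 : f 1 = 0) :
    lam * ∫ x in Ioo 0 1, f x ^ 2 = ∫ x in Ioo 0 1, powerCoeff θ x * deriv f x ^ 2 := by
  rw [h.setIntegral_density, setIntegral_sq]
  have i1 : IntervalIntegrable (fun x => x ^ (-θ) * q x ^ 2) volume 0 1 :=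
    (h.continuousOn_density hθ).intervalIntegrable_of_Icc zero_le_one
  have i2 : IntervalIntegrable (fun x => f x ^ 2) volume 0 1 := (h.cont.pow 2).intervalIntegrable _ _
  have := intervalIntegral.integral_eq_sub_of_hasDerivAt_of_le
    (f := fun x => f x * q x) (f' := fun x => x ^ (-θ) * q x ^ 2 - lam * f x ^ 2) zero_le_one
    (h.cont.mul h.continuous_flux).continuousOn
    (fun x hx => ((h.hasDeriv x hx.1).mul (h.hasDeriv_flux x)).congr_deriv (by ring))
    (i1.sub (i2.const_mul lam))
  rw [intervalIntegral.integral_sub i1 (i2.const_mul lam), intervalIntegral.integral_const_mul,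
    h1, h.flux_zero] at this
  linarith

/-- The multiplier identity for eigenfunctions. -/
theorem flux_one_sq (h : IsNeumannSolution θ lam f q) (hθ : θ < 2) (h1 : f 1 = 0) :
    q 1 ^ 2 = (2 - θ) * ∫ x in Ioo 0 1, powerCoeff θ x * deriv f x ^ 2 := by
  have hA := h.mul_integral_sq hθ h1
  rw [h.setIntegral_density, setIntegral_sq] at hA
  rw [h.setIntegral_density]
  have i1 : IntervalIntegrable (fun x => x ^ (-θ) * q x ^ 2) volume 0 1 :=
    (h.continuousOn_density hθ).intervalIntegrable_of_Icc zero_le_one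
  have i2 : IntervalIntegrable (fun x => f x ^ 2) volume 0 1 := (h.cont.pow 2).intervalIntegrable _ _
  -- This primitive comes from the multiplier `x f'`: the cross terms `∓2 lam x^(1-θ) f q` cancel.
  -- It is `q 1 ^ 2` at `1` and `0` at `0`, and `mul_integral_sq` turns the factor `1 - θ` into `2 -
  -- θ`.
  have := intervalIntegral.integral_eq_sub_of_hasDerivAt_of_le
    (f := fun x => x * (x ^ (-θ) * q x ^ 2) + lam * (x * f x ^ 2))
    (f' := fun x => (1 - θ) * (x ^ (-θ) * q x ^ 2) + lam * f x ^ 2) zero_le_one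
    ((continuousOn_id.mul (h.continuousOn_density hθ)).add
      (continuous_const.mul (continuous_id.mul (h.cont.pow 2))).continuousOn)
    (fun x hx => by
      have d1 := (hasDerivAt_id x).mul
        ((Real.hasDerivAt_rpow_const (p := -θ) (Or.inl hx.1.ne')).mul ((h.hasDeriv_flux x).pow 2))
      have d2 := ((hasDerivAt_id x).mul ((h.hasDeriv x hx.1).pow 2)).const_mul lam
      refine (d1.add d2).congr_deriv ?_
      rw [Real.rpow_sub_one hx.1.ne']
      simp only [id, Pi.mul_apply, Pi.pow_apply]
      have := hx.1.ne'
      field_simp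
      ring)
    ((i1.const_mul (1 - θ)).add (i2.const_mul lam))
  rw [intervalIntegral.integral_add (i1.const_mul (1 - θ)) (i2.const_mul lam),
    intervalIntegral.integral_const_mul, intervalIntegral.integral_const_mul, h1] at this
  simp only [Real.one_rpow] at this
  linarith

theorem integral_sq_pos (h : IsNeumannSolution θ lam f q) :
    0 < ∫ x in Ioo 0 1, f x ^ 2 := by
  rw [setIntegral_sq]
  exact intervalIntegral.integral_pos zero_lt_one (h.cont.pow 2).continuousOn
    (fun x _ => sq_nonneg _) ⟨0, left_mem_Icc.2 zero_le_one, by have := h.ne_zero; positivity⟩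

end IsNeumannSolution

/-! ### Standing waves as classical and mild solutions -/

theorem energy_congr_right {a f g g' : ℝ → ℝ} (h : EqOn g g' (Ioo 0 1)) :
    energy a f g = energy a f g' := by
  rw [energy, energy]
  congr 1
  exact setIntegral_congr_fun measurableSet_Ioo fun x hx => by simp only [h hx]

namespace IsNeumannSolution

variable {θ lam : ℝ} {f q c d : ℝ → ℝ}

theorem energy_smul (h : IsNeumannSolution θ lam f q) (hθ : θ < 2) (h1 : f 1 = 0) (r s : ℝ) :
    energy (powerCoeff θ) (r • f) (s • f) =
      (1 / 2) * (s ^ 2 + lam * r ^ 2) * ∫ x in Ioo 0 1, f x ^ 2 := by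
  rw [energy_const_smul r s h.integrableOn_sq (h.integrableOn_density hθ),
    ← h.mul_integral_sq hθ h1]
  ring

theorem ell_smul_eqOn (h : IsNeumannSolution θ lam f q) (r : ℝ) :
    EqOn (ell (powerCoeff θ) (r • f)) ((-lam * r) • f) (Ioo 0 1) := fun x hx => by
  rw [ell_const_smul]
  simp only [Pi.smul_apply, smul_eq_mul, h.ell_eq hx.1]
  ring

/-- Differences and difference quotients of standing waves are multiples of `f`, so their energy
limits reduce to scalar limits. -/
theorem tendsto_energy (h : IsNeumannSolution θ lam f q) (hθ : θ < 2) (h1 : f 1 = 0)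
    {l : Filter ℝ} {r s : ℝ → ℝ} (hr : Tendsto r l (𝓝 0)) (hs : Tendsto s l (𝓝 0)) :
    Tendsto (fun τ => energy (powerCoeff θ) (r τ • f) (s τ • f)) l (𝓝 0) := by
  simp only [h.energy_smul hθ h1]
  simpa [-one_div] using (((hs.pow 2).add ((hr.pow 2).const_mul lam)).const_mul (1 / 2)).mul_const
    (∫ x in Ioo 0 1, f x ^ 2)

theorem _root_.HasDerivAt.tendsto_slope_sub {c : ℝ → ℝ} {c' t : ℝ} (hc : HasDerivAt c c' t)
    (s : Set ℝ) : Tendsto (fun τ => (τ - t)⁻¹ * (c τ - c t) - c') (𝓝[s \ {t}] t) (𝓝 0) := by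
  have h1 := hasDerivAt_iff_tendsto_slope.1 hc
  have h2 : Tendsto (fun τ => slope c t τ - c') (𝓝[s \ {t}] t) (𝓝 0) := by
    simpa using (h1.mono_left (nhdsWithin_mono t fun x hx => hx.2)).sub_const c'
  simpa [slope_def_module] using h2

theorem _root_.ContinuousAt.tendsto_sub_nhdsWithin {c : ℝ → ℝ} {t : ℝ} (hc : ContinuousAt c t)
    (s : Set ℝ) : Tendsto (fun τ => c τ - c t) (𝓝[s] t) (𝓝 0) := by
  simpa using (hc.tendsto.sub_const (c t)).mono_left nhdsWithin_le_nhds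

theorem isClassicalSolution (h : IsNeumannSolution θ lam f q) (hθ : θ < 2) (h1 : f 1 = 0)
    (hc : ∀ t, HasDerivAt c (d t) t) (hd : ∀ t, HasDerivAt d (-lam * c t) t) :
    IsClassicalSolution (powerCoeff θ) (fun t => c t • f) (fun t => d t • f) where
  mem_u t _ := (h.memH2a hθ h1).const_smul _
  mem_v t _ := (h.memH1a hθ h1).const_smul _
  hasDeriv t _ := by
    refine (h.tendsto_energy hθ h1 ((hc t).tendsto_slope_sub (Ici 0))
      ((hd t).tendsto_slope_sub (Ici 0))).congr fun s => ?_
    simp only [sub_smul, mul_smul]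
    -- The eigenvalue equation for `ell` is known only for `x > 0`, so the functions are compared on
    -- the open interval alone.
    refine energy_congr_right fun x hx => ?_
    simp only [Pi.sub_apply, h.ell_smul_eqOn (c t) hx, Pi.smul_apply, smul_eq_mul]
    ring
  cont_deriv t _ := by
    have h2 := ((hc t).continuousAt.tendsto_sub_nhdsWithin (Ici 0)).const_mul (-lam)
    rw [mul_zero] at h2
    refine (h.tendsto_energy hθ h1 ((hd t).continuousAt.tendsto_sub_nhdsWithin (Ici 0))
      h2).congr fun s => ?_
    simp only [sub_smul]
    refine energy_congr_right fun x hx => ?_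
    simp only [Pi.sub_apply, h.ell_smul_eqOn _ hx, Pi.smul_apply, smul_eq_mul]
    ring

theorem isMildSolution (h : IsNeumannSolution θ lam f q) (hθ : θ < 2) (h1 : f 1 = 0)
    (hc : ∀ t, HasDerivAt c (d t) t) (hd : ∀ t, HasDerivAt d (-lam * c t) t) :
    IsMildSolution (powerCoeff θ) (c 0 • f) (d 0 • f) (fun t => c t • f) (fun t => d t • f) := by
  have hcc : Continuous c := continuous_iff_continuousAt.2 fun t => (hc t).continuousAt
  have hint : ∀ t, (fun x => ∫ s in (0 : ℝ)..t, (c s • f) x) = (∫ s in (0 : ℝ)..t, c s) • f := by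
    intro t
    ext x
    simp only [Pi.smul_apply, smul_eq_mul, intervalIntegral.integral_mul_const]
  -- The time-integrated oscillator equation; multiplied by `f`, it is the mild form of the wave
  -- equation.
  have hdint : ∀ t, -lam * ∫ s in (0 : ℝ)..t, c s = d t - d 0 := by
    intro t
    rw [← intervalIntegral.integral_const_mul]
    exact intervalIntegral.integral_eq_sub_of_hasDerivAt (fun s _ => hd s)
      ((continuous_const.mul hcc).intervalIntegrable _ _)
  have hf2 : MemL2 f := (h.memH1a hθ h1).1.memL2
  refine ⟨fun t _ => (h.memH1a hθ h1).const_smul _, fun t _ => MemLp.const_smul hf2 _,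
    fun t _ => ?_, fun t _ => ?_, fun x _ => rfl, Eventually.of_forall fun x => rfl,
    fun t _ => ?_, fun t _ => ?_⟩
  · simp only [← sub_smul]
    exact h.tendsto_energy hθ h1 ((hc t).continuousAt.tendsto_sub_nhdsWithin (Ici 0))
      ((hd t).continuousAt.tendsto_sub_nhdsWithin (Ici 0))
  · simp only [← sub_smul, ← mul_smul, eLpNorm_const_smul]
    have h2 := ENNReal.Tendsto.mul_const (b := eLpNorm f 2 mu01)
      ((hc t).tendsto_slope_sub (Ici 0)).enorm (Or.inr hf2.eLpNorm_ne_top)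
    simpa using h2
  · rw [hint]
    exact (h.memH2a hθ h1).const_smul _
  · rw [hint]
    filter_upwards [ae_restrict_mem measurableSet_Ioo] with x hx
    rw [Pi.add_apply, h.ell_smul_eqOn _ hx, hdint]
    simp only [Pi.smul_apply, smul_eq_mul]
    ring

theorem derivAtOne_smul (h : IsNeumannSolution θ lam f q) (r : ℝ) :
    derivAtOne (r • f) = r * q 1 := by
  have := (h.hasDeriv 1 one_pos).const_smul r
  rw [derivAtOne, this.hasDerivWithinAt.derivWithin (uniqueDiffWithinAt_Iic 1)]
  simp

theorem isNormalDeriv (h : IsNeumannSolution θ lam f q) (hθ : θ < 2) (h1 : f 1 = 0)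
    (hc : ∀ t, HasDerivAt c (d t) t) (hd : ∀ t, HasDerivAt d (-lam * c t) t) (T : ℝ) :
    IsNormalDeriv (powerCoeff θ) T (fun t => c t • f) (fun t => d t • f)
      fun t => c t * q 1 := by
  have hcc : Continuous c := continuous_iff_continuousAt.2 fun t => (hc t).continuousAt
  have hg : Continuous fun t => c t * q 1 := hcc.mul continuous_const
  -- The standing wave is itself classical, so a constant approximating sequence suffices.
  refine ⟨?_, fun _ t => c t • f, fun _ t => d t • f,
    fun _ => h.isClassicalSolution hθ h1 hc hd, ?_, ?_⟩
  · refine (memLp_two_iff_integrable_sq hg.aestronglyMeasurable).2 ?_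
    exact (hg.pow 2).continuousOn.integrableOn_Icc.mono_set Ioo_subset_Icc_self
  · simp [energy]
  · simp [h.derivAtOne_smul]

end IsNeumannSolution

/-! ### Choice of phase and the resulting bounds -/

/-- Over any time interval, one of `cos (ω t)` and `sin (ω t)` has mean square at most `1 / 2`. -/
theorem exists_oscillation_integral_le (ω T : ℝ) (hT : 0 < T) :
    ∃ c d : ℝ → ℝ, (∀ t, HasDerivAt c (d t) t) ∧ (∀ t, HasDerivAt d (-ω ^ 2 * c t) t) ∧
      d 0 ^ 2 + ω ^ 2 * c 0 ^ 2 = ω ^ 2 ∧ ∫ t in Ioo 0 T, c t ^ 2 ≤ T / 2 := by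
  have hl : ∀ t, HasDerivAt (fun t => ω * t) ω t := fun t => by
    simpa using (hasDerivAt_id t).const_mul ω
  have hcos : ∀ t, HasDerivAt (fun t => Real.cos (ω * t)) (-(ω * Real.sin (ω * t))) t := fun t =>
    (hl t).cos.congr_deriv (by ring)
  have hsin : ∀ t, HasDerivAt (fun t => Real.sin (ω * t)) (ω * Real.cos (ω * t)) t := fun t =>
    (hl t).sin.congr_deriv (by ring)
  have ic : IntegrableOn (fun t => Real.cos (ω * t) ^ 2) (Ioo 0 T) :=
    (by fun_prop : Continuous fun t => Real.cos (ω * t) ^ 2).continuousOn.integrableOn_Icc.mono_set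
      Ioo_subset_Icc_self
  have is : IntegrableOn (fun t => Real.sin (ω * t) ^ 2) (Ioo 0 T) :=
    (by fun_prop : Continuous fun t => Real.sin (ω * t) ^ 2).continuousOn.integrableOn_Icc.mono_set
      Ioo_subset_Icc_self
  -- The two integrals sum to `T`, so they cannot both exceed `T / 2`.
  have hsum : (∫ t in Ioo 0 T, Real.cos (ω * t) ^ 2) + ∫ t in Ioo 0 T, Real.sin (ω * t) ^ 2 = T := by
    rw [← integral_add ic is]
    simp [Real.cos_sq_add_sin_sq, hT.le]
  rcases le_total (∫ t in Ioo 0 T, Real.cos (ω * t) ^ 2) (T / 2) with hle | hle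
  · exact ⟨_, _, hcos, fun t => ((hsin t).const_mul ω).neg.congr_deriv (by ring), by simp, hle⟩
  · exact ⟨_, _, hsin, fun t => ((hcos t).const_mul ω).congr_deriv (by ring), by simp,
      by linarith⟩

theorem IsObsConst.le {θ T C : ℝ} (h0 : 1 ≤ θ) (hθ : θ < 2) (hT : 0 < T)
    (hC : IsObsConst (powerCoeff θ) T C) : C ≤ (2 - θ) * T := by
  obtain ⟨lam, f, q, hlam, h, h1⟩ := exists_eigenfunction (by linarith : 0 ≤ θ) hθ
  obtain ⟨c, d, hc, hd, hcd, hle⟩ := exists_oscillation_integral_le (√lam) T hT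
  rw [Real.sq_sqrt hlam.le] at hcd
  simp only [Real.sq_sqrt hlam.le] at hd
  have key := hC.2 _ _ ((h.memH1a hθ h1).const_smul (c 0))
    (MemLp.const_smul (h.memH1a hθ h1).1.memL2 (d 0)) _ _ _ (h.isMildSolution hθ h1 hc hd)
    (h.isNormalDeriv hθ h1 hc hd T)
  rw [h.energy_smul hθ h1, hcd] at key
  simp only [mul_pow] at key
  rw [integral_mul_const, h.flux_one_sq hθ h1, ← h.mul_integral_sq hθ h1] at key
  -- Both sides of `key` carry the factor `lam * ∫ f²`, whose positivity allows it to be cancelled.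
  have hA := mul_pos hlam h.integral_sq_pos
  have h2 : 0 ≤ (2 - θ) * (lam * ∫ x in Ioo 0 1, f x ^ 2) := mul_nonneg (by linarith) hA.le
  have h3 := mul_le_mul_of_nonneg_right hle h2
  refine le_of_mul_le_mul_right ?_ hA
  linarith

theorem obsConst_le {θ T : ℝ} (h0 : 1 ≤ θ) (hθ : θ < 2) (hT : 0 < T) :
    obsConst (powerCoeff θ) T ≤ ENNReal.ofReal ((2 - θ) * T) :=
  iSup₂_le fun _ hC => ENNReal.ofReal_le_ofReal (hC.le h0 hθ hT)

theorem le_obsTime {θ C : ℝ} (h0 : 1 ≤ θ) (hθ : θ < 2) :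
    ENNReal.ofReal (C / (2 - θ)) ≤ obsTime (powerCoeff θ) C := by
  refine le_iInf₂ fun T hT => ENNReal.ofReal_le_ofReal ?_
  rw [div_le_iff₀ (by linarith)]
  linarith [hT.2.le h0 hθ hT.1]

theorem eventually_one_le_and_lt_two : ∀ᶠ θ : ℝ in 𝓝[<] 2, 1 ≤ θ ∧ θ < 2 := by
  filter_upwards [Ico_mem_nhdsLT (by norm_num : (1 : ℝ) < 2)] with θ hθ using hθ

end DegWave

end

theorem mainTheorem4 :
    (∀ T : ℝ, 0 < T → ∀ θ : ℝ, 1 ≤ θ → θ < 2 →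
      DegWave.obsConst (DegWave.powerCoeff θ) T ≤ ENNReal.ofReal ((2 - θ) * T)) ∧
    (∀ T : ℝ, 0 < T →
      Tendsto (fun θ : ℝ => DegWave.obsConst (DegWave.powerCoeff θ) T) (𝓝[<] 2) (𝓝 0)) ∧
    (∀ C : ℝ, 0 < C → ∀ θ : ℝ, 1 ≤ θ → θ < 2 →
      ENNReal.ofReal (C / (2 - θ)) ≤ DegWave.obsTime (DegWave.powerCoeff θ) C) ∧
    (∀ C : ℝ, 0 < C →
      Tendsto (fun θ : ℝ => DegWave.obsTime (DegWave.powerCoeff θ) C) (𝓝[<] 2) (𝓝 ⊤)) := by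
  have hsub : Tendsto (fun θ : ℝ => 2 - θ) (𝓝[<] 2) (𝓝 0) := by
    have : Tendsto (fun θ : ℝ => 2 - θ) (𝓝 2) (𝓝 (2 - 2)) := tendsto_id.const_sub 2
    rw [sub_self] at this
    exact this.mono_left nhdsWithin_le_nhds
  refine ⟨fun T hT θ h0 hθ => DegWave.obsConst_le h0 hθ hT, fun T hT => ?_,
    fun C _ θ h0 hθ => DegWave.le_obsTime h0 hθ, fun C hC => ?_⟩
  · have hlim : Tendsto (fun θ : ℝ => ENNReal.ofReal ((2 - θ) * T)) (𝓝[<] 2) (𝓝 0) := by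
      have := ENNReal.tendsto_ofReal (hsub.mul_const T)
      rwa [zero_mul, ENNReal.ofReal_zero] at this
    refine tendsto_of_tendsto_of_tendsto_of_le_of_le' tendsto_const_nhds hlim
      (Eventually.of_forall fun _ => zero_le) ?_
    filter_upwards [DegWave.eventually_one_le_and_lt_two] with θ hθ
      using DegWave.obsConst_le hθ.1 hθ.2 hT
  -- Approach to `0` from the right is what makes `C / (2 - θ)` tend to `+∞`.
  · have hpos : Tendsto (fun θ : ℝ => 2 - θ) (𝓝[<] 2) (𝓝[>] 0) := by
      refine tendsto_nhdsWithin_iff.2 ⟨hsub, ?_⟩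
      filter_upwards [self_mem_nhdsWithin] with θ hθ
      exact sub_pos.2 (mem_Iio.1 hθ)
    have hlim : Tendsto (fun θ : ℝ => ENNReal.ofReal (C / (2 - θ))) (𝓝[<] 2) (𝓝 ⊤) :=
      ENNReal.tendsto_ofReal_atTop.comp
        ((tendsto_inv_nhdsGT_zero.comp hpos).const_mul_atTop hC)
    refine tendsto_nhds_top_mono hlim ?_
    filter_upwards [DegWave.eventually_one_le_and_lt_two] with θ hθ
      using DegWave.le_obsTime hθ.1 hθ.2
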